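/- Let $n,d\ge 1$ and $k\ge 0$ be integers, and for $\theta\in[0,1]^d$ let $X_1,\dots,X_n$ be i.i.d. from the product Bernoulli distribution $\prod_{i=1}^d\mathrm{Bern}(\theta_i)$ on $\{0,1\}^d$. Node $j\in\{1,\dots,n\}$ observes $X_j$ and communicates $k$ bits, according to a protocol $\Pi$ of one of the following types. - Independent: node $j$ sends a message $M_j\in\{1,\dots,2^k\}$ drawn from a conditional distribution $p_j(\cdot\mid X_j)$, independently of the other nodes. - Sequential: $M_j\in\{1,\dots,2^k\}$ is drawn from a conditional distribution $p_j(\cdot\mid X_j;M_1,\dots,M_{j-1})$, for $j=1,\dots,n$ in turn. - Blackboard: a complete binary tree of depth $nk$, in which each internal node $v$ has a label $l_v\in\{1,\dots,n\}$ and a function $b_v:\{0,1\}^d\to[0,1]$, such that every path from the root to a leaf visits exactly $k$ internal nodes with label $j$, for each $j$. Starting at the root, when the protocol is at $v$, node $l_v$ writes the bit $1$ with probability $b_v(X_{l_v})$ and the bit $0$ otherwise, and the protocol moves to the corresponding child of $v$. The transcript $Y$ is $(M_1,\dots,M_n)$ for the first two types and the sequence of the $nk$ written bits for the third. An estimator is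 any function $\hat\theta=\hat\theta(Y)\in\mathbb{R}^d$ of the transcript. Then there is a universal constant $C>0$, independent of $n,k,d$, such that the following hold for every protocol $\Pi$ of any of the three types and every estimator $\hat\theta$. 1. If $n\min\{k,d\}\ge d$, then $$\sup_{\theta\in[0,1]^d}\mathbb{E}_\theta\|\hat\theta-\theta\|_2^2\ \ge\ C\max\left\{\frac{d^2}{nk},\frac dn\right\}.$$ 2. If $d\ge 2$ and $n\min\{2^k,d\}\ge d^2$, then $$\sup_{\theta\in[0,1]^d,\ \sum_i\theta_i=1}\mathbb{E}_\theta\|\hat\theta-\theta\|_2^2\ \ge\ C\max\left\{\frac{d}{n2^k},\frac1n\right\}.$$ -/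

import Mathlib

open scoped BigOperators

noncomputable section

namespace DistEst

/-- A sample of the `d`-dimensional product Bernoulli model: a point of `{0,1}^d`. -/
abbrev Sample (d : ℕ) : Type := Fin d → Bool

/-- A `k`-bit message, an element of `[2^k]`. -/
abbrev Msg (k : ℕ) : Type := Fin (2 ^ k)

/-- The entries of `y` at the positions strictly before `t`. -/
def before {N : ℕ} {α : Type} (y : Fin N → α) (t : Fin N) : Fin (t : ℕ) → α :=
  fun s => y (s.castLE t.isLt.le)

/-- The probability of `x` under `∏ i, Bern (θ i)`. -/
def bernMass {d : ℕ} (θ : EuclideanSpace ℝ (Fin d)) (x : Sample d) : ℝ :=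
  ∏ i, if x i then θ i else 1 - θ i

/-- The probability of `(x 1, …, x n)` when the samples are i.i.d. from `∏ i, Bern (θ i)`. -/
def iidMass {d n : ℕ} (θ : EuclideanSpace ℝ (Fin d)) (x : Fin n → Sample d) : ℝ :=
  ∏ j, bernMass θ (x j)

/-- Independent protocols: node `i` has a randomized `k`-bit quantizer `p(m | x)`. -/
structure IndProtocol (n k d : ℕ) where
  quantizer : Fin n → Sample d → stdSimplex ℝ (Msg k)

/-- The conditional probability of the messages `m` given the samples `x`. -/
def IndProtocol.law {n k d : ℕ} (P : IndProtocol n k d)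
    (x : Fin n → Sample d) (m : Fin n → Msg k) : ℝ :=
  ∏ i, (P.quantizer i (x i)).1 (m i)

/-- Sequential protocols: the randomized quantizer `p(m_i | x_i; m_1, …, m_{i-1})` of node `i`
depends on the messages sent earlier. -/
structure SeqProtocol (n k d : ℕ) where
  quantizer : (i : Fin n) → (Fin (i : ℕ) → Msg k) → Sample d → stdSimplex ℝ (Msg k)

/-- The conditional probability of the messages `m` given the samples `x`. -/
def SeqProtocol.law {n k d : ℕ} (P : SeqProtocol n k d)
    (x : Fin n → Sample d) (m : Fin n → Msg k) : ℝ :=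
  ∏ i, (P.quantizer i (before m i) (x i)).1 (m i)

/-- Blackboard protocols: a complete binary tree of depth `n * k`. An internal node is given by
its depth `t` and by the `t` bits written so far. It carries the label of the node of the network
that writes the next bit, and the probability `b_v(x)` with which that node writes `1` (`true`)
when its sample is `x`. Every path from the root to a leaf, that is every transcript `y`, visits
exactly `k` internal nodes with label `i`, for each `i`. -/
structure BBProtocol (n k d : ℕ) where
  label : (t : Fin (n * k)) → (Fin (t : ℕ) → Bool) → Fin n
  bitProb : (t : Fin (n * k)) → (Fin (t : ℕ) → Bool) → Sample d → unitInterval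
  budget : ∀ (y : Fin (n * k) → Bool) (i : Fin n),
    (Finset.univ.filter fun t : Fin (n * k) => label t (before y t) = i).card = k

/-- The conditional probability of the transcript `y` given the samples `x`. -/
def BBProtocol.law {n k d : ℕ} (P : BBProtocol n k d)
    (x : Fin n → Sample d) (y : Fin (n * k) → Bool) : ℝ :=
  ∏ t, if y t then (P.bitProb t (before y t) (x (P.label t (before y t))) : ℝ)
    else 1 - (P.bitProb t (before y t) (x (P.label t (before y t))) : ℝ)

/-- The risk `𝔼_θ ‖θ̂(Y) - θ‖₂²` of the estimator `est`, where the transcript `Y` has conditional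
probabilities `law x` given the i.i.d. samples `x`. -/
def risk {n d : ℕ} {Y : Type} [Fintype Y] (law : (Fin n → Sample d) → Y → ℝ)
    (est : Y → EuclideanSpace ℝ (Fin d)) (θ : EuclideanSpace ℝ (Fin d)) : ℝ :=
  ∑ x : Fin n → Sample d, iidMass θ x * ∑ y, law x y * ‖est y - θ‖ ^ 2

/-- The worst-case risk `sup_{θ ∈ Θ} 𝔼_θ ‖θ̂(Y) - θ‖₂²`. -/
def worstRisk {n d : ℕ} {Y : Type} [Fintype Y] (law : (Fin n → Sample d) → Y → ℝ)
    (est : Y → EuclideanSpace ℝ (Fin d)) (Θ : Set (EuclideanSpace ℝ (Fin d))) : ℝ :=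
  ⨆ θ : Θ, risk law est (θ : EuclideanSpace ℝ (Fin d))

/-- Every estimator based on `n` samples and on any protocol with `k` bits per node, independent,
sequential or blackboard, has worst-case risk at least `r` over `Θ`. -/
def RiskAtLeast (n k d : ℕ) (Θ : Set (EuclideanSpace ℝ (Fin d))) (r : ℝ) : Prop :=
  (∀ (P : IndProtocol n k d) (est : (Fin n → Msg k) → EuclideanSpace ℝ (Fin d)),
      r ≤ worstRisk P.law est Θ) ∧
  (∀ (P : SeqProtocol n k d) (est : (Fin n → Msg k) → EuclideanSpace ℝ (Fin d)),
      r ≤ worstRisk P.law est Θ) ∧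
  (∀ (P : BBProtocol n k d) (est : (Fin (n * k) → Bool) → EuclideanSpace ℝ (Fin d)),
      r ≤ worstRisk P.law est Θ)

/-- The cube `[0,1]^d`. -/
def cube (d : ℕ) : Set (EuclideanSpace ℝ (Fin d)) :=
  {θ | ∀ i, θ i ∈ Set.Icc (0 : ℝ) 1}

/-- The sparse parameter set `{θ ∈ [0,1]^d : ∑ i, θ i = 1}`. -/
def sparseSet (d : ℕ) : Set (EuclideanSpace ℝ (Fin d)) :=
  {θ | (∀ i, θ i ∈ Set.Icc (0 : ℝ) 1) ∧ ∑ i, θ i = 1}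

end DistEst

end

open scoped BigOperators

noncomputable section

namespace DistEst

open Finset MeasureTheory

/-! For all three protocol types, the law of the transcript given the samples is a product over
nodes of factors `q j (x j) y` in `[0,1]`, and deleting one node's factor leaves total mass `2 ^ k`:
replacing that node's output by uniform bits gives a probability law in which its factor is the
constant `2⁻ᵏ`. `IsKernel` records exactly this, so the rest of the argument treats all protocols at
once.

Because of the product form, the transcript score is the sum of the nodes' conditional scores. These
are centered and pairwise uncorrelated, so the trace of the Fisher information adds up over nodes
(`trace_fisher_eq`). One node contributes at most the trace for a full sample, at most `K * 2 ^ k`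
if the one-sample information matrix is bounded by `K`, and at most `2 * log (2 ^ k)` if the
one-sample score is sub-Gaussian.

A van Trees inequality on `[-1,1]^(m+1)`, obtained from the divergence theorem, turns these bounds
into risk bounds. On the cube, the family `1/2 + t/4` uses the logarithmic bound for `d²/(nk)` and
the trace bound for `d/n`. On the simplex, coordinates near `1/d` are moved in opposite pairs by at
most `1/(2d)`, so that `K = 2/d`; the `2 ^ k` bound gives `d/(n 2ᵏ)` and the trace bound gives
`1/n`. -/

/-! ### Product-form kernels of the three protocol types -/

/-- A transcript kernel in product form: `∏ j, q j (x j) y` is a conditional probability of the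
transcript `y` given the samples `x`, and its total mass becomes `B` when the factor of any single
node is removed. -/
structure IsKernel {X Y : Type} [Fintype Y] {n : ℕ} (q : Fin n → X → Y → ℝ) (B : ℝ) : Prop where
  nonneg : ∀ j x y, 0 ≤ q j x y
  le_one : ∀ j x y, q j x y ≤ 1
  sum_prod : ∀ x : Fin n → X, ∑ y, ∏ j, q j (x j) y = 1
  sum_prod_erase : ∀ (j : Fin n) (x : Fin n → X), ∑ y, ∏ i ∈ univ.erase j, q i (x i) y = B

theorem before_snoc_castSucc {N : ℕ} {α : Type} (y : Fin N → α) (a : α) (t : Fin N) :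
    before (Fin.snoc (α := fun _ => α) y a) t.castSucc = before y t := by
  funext s
  exact Fin.snoc_castSucc (α := fun _ => α) a y (s.castLE t.isLt.le)

theorem before_snoc_last {N : ℕ} {α : Type} (y : Fin N → α) (a : α) :
    before (Fin.snoc (α := fun _ => α) y a) (Fin.last N) = y := by
  funext s
  exact Fin.snoc_castSucc (α := fun _ => α) a y s

/-- Writing symbols one after the other, each drawn from a conditional distribution given the
previous ones, defines a probability distribution on sequences. -/
theorem sum_prod_before {N : ℕ} {α : Type} [Fintype α]
    (f : (t : Fin N) → (Fin (t : ℕ) → α) → α → ℝ) (hf : ∀ t h, ∑ a, f t h a = 1) :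
    ∑ y : Fin N → α, ∏ t, f t (before y t) (y t) = 1 := by
  induction N with
  | zero => simp
  | succ N ih =>
    -- Summing out the last symbol, whose conditional masses add up to one, leaves the claim for the
    -- shorter sequences.
    rw [← (Fin.snocEquiv fun _ : Fin (N + 1) => α).sum_comp, Fintype.sum_prod_type, sum_comm]
    rw [← ih (fun t h a => f t.castSucc h a) (fun t h => hf t.castSucc h)]
    refine sum_congr rfl fun y _ => ?_
    have key : ∀ a, ∏ t, f t (before ((Fin.snocEquiv fun _ : Fin (N + 1) => α) (a, y)) t)
        ((Fin.snocEquiv fun _ : Fin (N + 1) => α) (a, y) t)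
        = (∏ t : Fin N, f t.castSucc (before y t) (y t)) * f (Fin.last N) y a := by
      intro a
      change ∏ t, f t (before (Fin.snoc (α := fun _ => α) y a) t)
        (Fin.snoc (α := fun _ => α) y a t) = _
      rw [Fin.prod_univ_castSucc, before_snoc_last]
      simp only [before_snoc_castSucc, Fin.snoc_castSucc, Fin.snoc_last]
    rw [sum_congr rfl fun a _ => key a, ← mul_sum]
    erw [hf (Fin.last N) y]
    rw [mul_one]

/-- The factor of node `i` in the law of a sequential protocol. -/
def SeqProtocol.factor {n k d : ℕ} (P : SeqProtocol n k d) (i : Fin n) (x : Sample d)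
    (m : Fin n → Msg k) : ℝ :=
  (P.quantizer i (before m i) x).1 (m i)

theorem SeqProtocol.isKernel_factor {n k d : ℕ} (P : SeqProtocol n k d) :
    IsKernel P.factor (2 ^ k) where
  nonneg j x y := (P.quantizer j (before y j) x).2.1 _
  le_one j x y := by
    have h := (P.quantizer j (before y j) x).2
    rw [SeqProtocol.factor, ← h.2]
    exact single_le_sum (fun i _ => h.1 i) (mem_univ (y j))
  sum_prod x := sum_prod_before (fun i h a => (P.quantizer i h (x i)).1 a)
    fun i h => (P.quantizer i h (x i)).2.2
  sum_prod_erase j x := by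
    -- Node `j` is replaced by one that sends a uniform message; its factor `2⁻ᵏ` then comes out of
    -- the sum.
    have h := sum_prod_before (N := n) (α := Msg k)
      (fun i h a => if i = j then ((2 : ℝ) ^ k)⁻¹ else (P.quantizer i h (x i)).1 a) (by
        intro i h
        by_cases hij : i = j
        · simp [hij]
        · simpa [hij] using (P.quantizer i h (x i)).2.2)
    have h2 : ∀ y : Fin n → Msg k,
        ∏ i, (if i = j then ((2 : ℝ) ^ k)⁻¹ else (P.quantizer i (before y i) (x i)).1 (y i))
          = ((2 : ℝ) ^ k)⁻¹ * ∏ i ∈ univ.erase j, P.factor i (x i) y := by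
      intro y
      rw [← mul_prod_erase univ _ (mem_univ j), if_pos rfl]
      congr 1
      refine prod_congr rfl fun i hi => ?_
      rw [if_neg (ne_of_mem_erase hi)]
      rfl
    rw [sum_congr rfl fun y _ => h2 y, ← mul_sum] at h
    field_simp at h
    exact h

/-- An independent protocol, seen as a sequential one. -/
def IndProtocol.toSeq {n k d : ℕ} (P : IndProtocol n k d) : SeqProtocol n k d where
  quantizer i _ x := P.quantizer i x

/-- The conditional probability of the bit written at depth `t`, given the sample of its writer. -/
def BBProtocol.bitMass {n k d : ℕ} (P : BBProtocol n k d) (t : Fin (n * k))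
    (h : Fin (t : ℕ) → Bool) (x : Sample d) (a : Bool) : ℝ :=
  if a then (P.bitProb t h x : ℝ) else 1 - (P.bitProb t h x : ℝ)

/-- The factor of node `i` in the law of a blackboard protocol. -/
def BBProtocol.factor {n k d : ℕ} (P : BBProtocol n k d) (i : Fin n) (x : Sample d)
    (y : Fin (n * k) → Bool) : ℝ :=
  ∏ t ∈ univ.filter fun t : Fin (n * k) => P.label t (before y t) = i,
    P.bitMass t (before y t) x (y t)

theorem BBProtocol.bitMass_nonneg {n k d : ℕ} (P : BBProtocol n k d) (t : Fin (n * k))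
    (h : Fin (t : ℕ) → Bool) (x : Sample d) (a : Bool) : 0 ≤ P.bitMass t h x a := by
  have := (P.bitProb t h x).2
  cases a <;> simp [bitMass, this.1, this.2]

theorem BBProtocol.bitMass_le_one {n k d : ℕ} (P : BBProtocol n k d) (t : Fin (n * k))
    (h : Fin (t : ℕ) → Bool) (x : Sample d) (a : Bool) : P.bitMass t h x a ≤ 1 := by
  have := (P.bitProb t h x).2
  cases a <;> simp [bitMass, this.1, this.2]

theorem BBProtocol.prod_factor {n k d : ℕ} (P : BBProtocol n k d) (x : Fin n → Sample d)
    (y : Fin (n * k) → Bool) : ∏ i, P.factor i (x i) y = P.law x y := by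
  change _ = ∏ t, P.bitMass t (before y t) (x (P.label t (before y t))) (y t)
  rw [← prod_fiberwise univ (fun t => P.label t (before y t))]
  refine prod_congr rfl fun i _ => prod_congr rfl fun t ht => ?_
  rw [(mem_filter.1 ht).2]

theorem BBProtocol.isKernel_factor {n k d : ℕ} (P : BBProtocol n k d) :
    IsKernel P.factor (2 ^ k) where
  nonneg j x y := prod_nonneg fun t _ => P.bitMass_nonneg _ _ _ _
  le_one j x y := prod_le_one (fun t _ => P.bitMass_nonneg _ _ _ _)
    fun t _ => P.bitMass_le_one _ _ _ _
  sum_prod x := by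
    simp only [P.prod_factor]
    exact sum_prod_before (fun t h a => P.bitMass t h (x (P.label t h)) a)
      fun t h => by simp [bitMass]
  sum_prod_erase j x := by
    -- Every bit written by node `j` is replaced by a fair coin. By `budget` each transcript
    -- contains exactly `k` of them, so the extracted factor `2⁻ᵏ` does not depend on `y`.
    have h := sum_prod_before (N := n * k) (α := Bool)
      (fun t h a => if P.label t h = j then (2 : ℝ)⁻¹ else P.bitMass t h (x (P.label t h)) a) (by
        intro t h
        by_cases hj : P.label t h = j
        · simp [hj]
        · simp [hj, bitMass])
    have h2 : ∀ y : Fin (n * k) → Bool,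
        ∏ t, (if P.label t (before y t) = j then (2 : ℝ)⁻¹
            else P.bitMass t (before y t) (x (P.label t (before y t))) (y t))
          = ((2 : ℝ) ^ k)⁻¹ * ∏ i ∈ univ.erase j, P.factor i (x i) y := by
      intro y
      rw [← prod_fiberwise univ (fun t => P.label t (before y t)),
        ← mul_prod_erase univ _ (mem_univ j)]
      congr 1
      · rw [prod_congr rfl fun t ht => if_pos (mem_filter.1 ht).2, prod_const, P.budget y j,
          inv_pow]
      · refine prod_congr rfl fun i hi => prod_congr rfl fun t ht => ?_
        rw [(mem_filter.1 ht).2, if_neg (ne_of_mem_erase hi)]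
    rw [sum_congr rfl fun y _ => h2 y, ← mul_sum] at h
    field_simp at h
    exact h

/-! ### Van Trees inequality from the divergence theorem -/

/-- A continuously differentiable vector field on `[-1,1]^(m+1)` that is tangent to the faces has
nonnegative divergence somewhere. -/
theorem exists_divergence_nonneg {m : ℕ} (V : Fin (m + 1) → (Fin (m + 1) → ℝ) → ℝ)
    (hV : ∀ l, ContDiff ℝ 1 (V l)) (hface : ∀ l t, t l ^ 2 = 1 → V l t = 0) :
    ∃ t : Fin (m + 1) → ℝ, (∀ l, t l ∈ Set.Icc (-1 : ℝ) 1) ∧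
      0 ≤ ∑ l, fderiv ℝ (V l) t (Pi.single l 1) := by
  -- The total divergence equals the flux through the faces, which is zero. A divergence negative on
  -- the compact box would have a negative maximum `M`, and its integral would be at most `M` times
  -- the positive volume.
  by_contra! hneg
  set a : Fin (m + 1) → ℝ := fun _ => -1
  set b : Fin (m + 1) → ℝ := fun _ => 1
  have hab : a ≤ b := fun _ => by norm_num [a, b]
  have hcont : Continuous fun t => ∑ l, fderiv ℝ (V l) t (Pi.single l 1) :=
    continuous_finsetSum _ fun l _ => ((hV l).continuous_fderiv one_ne_zero).clm_apply
      continuous_const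
  have hint : IntegrableOn (fun t => ∑ l, fderiv ℝ (V l) t (Pi.single l 1)) (Set.Icc a b) :=
    hcont.continuousOn.integrableOn_compact isCompact_Icc
  have h := integral_divergence_of_hasFDerivAt_off_countable' a b hab V
    (fun l => fderiv ℝ (V l)) ∅ Set.countable_empty (fun l => (hV l).continuous.continuousOn)
    (fun t _ l => ((hV l).differentiable one_ne_zero t).hasFDerivAt) hint
  have hzero : ∀ l : Fin (m + 1), ∀ c : ℝ, c ^ 2 = 1 → ∀ u : Fin m → ℝ,
      V l (l.insertNth (α := fun _ => ℝ) c u) = 0 :=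
    fun l c hc u => hface l _ (by rw [Fin.insertNth_apply_same]; exact hc)
  have hrhs : ∫ t in Set.Icc a b, ∑ l, fderiv ℝ (V l) t (Pi.single l 1) = 0 := by
    rw [h]
    refine sum_eq_zero fun l _ => ?_
    simp [a, b, hzero l 1 (by norm_num), hzero l (-1) (by norm_num)]
  obtain ⟨t₀, ht₀, hmax⟩ := (isCompact_Icc (a := a) (b := b)).exists_isMaxOn
    (Set.nonempty_Icc.2 hab) hcont.continuousOn
  set M := ∑ l, fderiv ℝ (V l) t₀ (Pi.single l 1)
  have hM : M < 0 := hneg t₀ fun l => ⟨ht₀.1 l, ht₀.2 l⟩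
  have hle : ∫ t in Set.Icc a b, ∑ l, fderiv ℝ (V l) t (Pi.single l 1)
      ≤ ∫ _ in Set.Icc a b, M :=
    setIntegral_mono_on hint (integrableOn_const isCompact_Icc.measure_ne_top) measurableSet_Icc
      fun t ht => hmax ht
  rw [hrhs, setIntegral_const, Measure.real, Real.volume_Icc_pi] at hle
  have hpos : 0 < (∏ i, ENNReal.ofReal (b i - a i)).toReal := by
    rw [ENNReal.toReal_prod]
    refine prod_pos fun i _ => ?_
    norm_num [a, b]
  rw [smul_eq_mul] at hle
  nlinarith

/-- The Cauchy–Schwarz inequality for vector-valued functions on a finite weighted space. -/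
theorem sq_sum_mul_sum_le {Y ι : Type*} [Fintype Y] [Fintype ι] (p : Y → ℝ) (hp : ∀ y, 0 ≤ p y)
    (u v : Y → ι → ℝ) :
    (∑ y, p y * ∑ l, u y l * v y l) ^ 2
      ≤ (∑ y, p y * ∑ l, u y l ^ 2) * ∑ y, p y * ∑ l, v y l ^ 2 := by
  have h := sum_mul_sq_le_sq_mul_sq (univ : Finset (Y × ι))
    (fun z => √(p z.1) * u z.1 z.2) (fun z => √(p z.1) * v z.1 z.2)
  simp only [Fintype.sum_prod_type, mul_pow, Real.sq_sqrt (hp _), ← mul_sum] at h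
  refine le_trans (le_of_eq ?_) h
  congr 1
  refine sum_congr rfl fun y _ => ?_
  rw [mul_sum]
  refine sum_congr rfl fun l _ => ?_
  rw [mul_mul_mul_comm, Real.mul_self_sqrt (hp y)]

/-- A multivariate van Trees inequality on the box `[-1,1]^(m+1)`: if the Fisher information of a
family of distributions `p t` with score `s t` has trace at most `I`, the worst-case risk `R` of
an estimator of `t` satisfies `(2 (m+1) / 3)² ≤ R (2 I + 8 (m+1))`. -/
theorem vanTrees {m : ℕ} {Y : Type*} [Fintype Y] (p : (Fin (m + 1) → ℝ) → Y → ℝ)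
    (s : (Fin (m + 1) → ℝ) → Y → Fin (m + 1) → ℝ) (est : Y → Fin (m + 1) → ℝ) (I R : ℝ)
    (hp : ∀ y, ContDiff ℝ 1 fun t => p t y) (hsum : ∀ t, ∑ y, p t y = 1)
    (hpos : ∀ t, (∀ l, t l ∈ Set.Icc (-1 : ℝ) 1) → ∀ y, 0 ≤ p t y)
    (hs : ∀ t, (∀ l, t l ∈ Set.Icc (-1 : ℝ) 1) → ∀ y l,
      fderiv ℝ (fun t => p t y) t (Pi.single l 1) = p t y * s t y l)
    (hI : ∀ t, (∀ l, t l ∈ Set.Icc (-1 : ℝ) 1) → ∑ y, p t y * ∑ l, s t y l ^ 2 ≤ I)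
    (hR : ∀ t, (∀ l, t l ∈ Set.Icc (-1 : ℝ) 1) → ∑ y, p t y * ∑ l, (est y l - t l) ^ 2 ≤ R) :
    (2 * ((m : ℝ) + 1) / 3) ^ 2 ≤ R * (2 * I + 8 * ((m : ℝ) + 1)) := by
  -- The weight `1 - t l ^ 2` vanishes on the faces. The constant `2 / 3` is its mean on `[-1,1]`;
  -- with this coefficient, the part of the divergence not expressed through the error `est y l - t
  -- l` is the constant `-2 / 3` per coordinate.
  set V : Fin (m + 1) → (Fin (m + 1) → ℝ) → ℝ := fun l t =>
    (1 - t l ^ 2) * (∑ y, p t y * est y l - 2 / 3 * t l)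
  have hcoord : ∀ l : Fin (m + 1), ContDiff ℝ 1 fun t : Fin (m + 1) → ℝ => t l :=
    fun l => contDiff_apply ℝ ℝ l
  have hmean : ∀ l, ContDiff ℝ 1 fun t => ∑ y, p t y * est y l := fun l =>
    ContDiff.sum fun y _ => (hp y).mul contDiff_const
  have hV : ∀ l, ContDiff ℝ 1 (V l) := fun l =>
    (contDiff_const.sub ((hcoord l).pow 2)).mul ((hmean l).sub (contDiff_const.mul (hcoord l)))
  obtain ⟨t, ht, hdiv⟩ := exists_divergence_nonneg V hV
    (fun l t htl => by simp [V, htl])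
  have hsumzero : ∀ l, ∑ y, p t y * s t y l = 0 := by
    intro l
    have h1 : HasFDerivAt (fun t => ∑ y, p t y) (∑ y, fderiv ℝ (fun t => p t y) t) t :=
      HasFDerivAt.fun_sum fun y _ => ((hp y).differentiable one_ne_zero t).hasFDerivAt
    have h2 : HasFDerivAt (fun t => ∑ y, p t y) (0 : (Fin (m + 1) → ℝ) →L[ℝ] ℝ) t := by
      simp only [hsum]
      exact hasFDerivAt_const _ _
    have h3 := congrArg (fun L => L (Pi.single l (1 : ℝ))) (h1.unique h2)
    simpa [hs t ht] using h3
  have hderiv : ∀ l, fderiv ℝ (V l) t (Pi.single l 1)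
      = (1 - t l ^ 2) * (∑ y, p t y * s t y l * est y l - 2 / 3)
        - 2 * t l * (∑ y, p t y * est y l - 2 / 3 * t l) := by
    intro l
    have hc : HasFDerivAt (fun t : Fin (m + 1) → ℝ => t l)
        (ContinuousLinearMap.proj (R := ℝ) (φ := fun _ : Fin (m + 1) => ℝ) l) t :=
      hasFDerivAt_apply l t
    have hm : HasFDerivAt (fun t => ∑ y, p t y * est y l)
        (∑ y, est y l • fderiv ℝ (fun t => p t y) t) t :=
      HasFDerivAt.fun_sum fun y _ =>
        ((hp y).differentiable one_ne_zero t).hasFDerivAt.mul_const (est y l)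
    have h : HasFDerivAt (V l) _ t :=
      ((hasFDerivAt_const (1 : ℝ) t).sub (hc.pow 2)).mul (hm.sub (hc.const_mul (2 / 3)))
    rw [h.fderiv]
    simp [hs t ht]
    simp only [mul_comm, mul_left_comm]
    ring
  have hdiv2 : ∑ l, fderiv ℝ (V l) t (Pi.single l 1)
      = ∑ y, p t y * ∑ l, (est y l - t l) * ((1 - t l ^ 2) * s t y l - 2 * t l)
        - 2 * ((m : ℝ) + 1) / 3 := by
    have h : ∀ l, fderiv ℝ (V l) t (Pi.single l 1)
        = ∑ y, p t y * ((est y l - t l) * ((1 - t l ^ 2) * s t y l - 2 * t l)) - 2 / 3 := by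
      intro l
      have e : ∑ y, p t y * ((est y l - t l) * ((1 - t l ^ 2) * s t y l - 2 * t l))
          = (1 - t l ^ 2) * ∑ y, p t y * s t y l * est y l - 2 * t l * ∑ y, p t y * est y l
            - t l * (1 - t l ^ 2) * ∑ y, p t y * s t y l + 2 * t l ^ 2 * ∑ y, p t y := by
        simp only [mul_sum, ← sum_sub_distrib, ← sum_add_distrib]
        refine sum_congr rfl fun y _ => ?_
        ring
      rw [hderiv l, e, hsumzero l, hsum t]
      ring
    simp only [h, sum_sub_distrib, mul_sum]
    rw [sum_comm]
    simp
    ring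
  rw [hdiv2] at hdiv
  have hcs := sq_sum_mul_sum_le (p t) (hpos t ht) (fun y l => est y l - t l)
    (fun y l => (1 - t l ^ 2) * s t y l - 2 * t l)
  have hw : ∑ y, p t y * ∑ l, ((1 - t l ^ 2) * s t y l - 2 * t l) ^ 2
      ≤ 2 * I + 8 * ((m : ℝ) + 1) := by
    -- Here `(a - b)² ≤ 2a² + 2b²` is used with `|1 - t l ^ 2| ≤ 1` and `(2 * t l)² ≤ 4`.
    have h1 : ∀ y, ∑ l, ((1 - t l ^ 2) * s t y l - 2 * t l) ^ 2
        ≤ 2 * ∑ l, s t y l ^ 2 + 8 * ((m : ℝ) + 1) := by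
      intro y
      calc _ ≤ ∑ l, (2 * s t y l ^ 2 + 8) := by
            refine sum_le_sum fun l _ => ?_
            have h := ht l
            have ht2 : t l ^ 2 ≤ 1 := by nlinarith [h.1, h.2]
            have hA : ((1 - t l ^ 2) * s t y l) ^ 2 ≤ s t y l ^ 2 := by
              rw [mul_pow]
              refine mul_le_of_le_one_left (sq_nonneg _) ?_
              nlinarith [sq_nonneg (t l)]
            nlinarith [sq_nonneg ((1 - t l ^ 2) * s t y l + 2 * t l)]
        _ = _ := by
          rw [sum_add_distrib, mul_sum]
          simp
          ring
    calc _ ≤ ∑ y, p t y * (2 * ∑ l, s t y l ^ 2 + 8 * ((m : ℝ) + 1)) :=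
          sum_le_sum fun y _ => mul_le_mul_of_nonneg_left (h1 y) (hpos t ht y)
      _ = 2 * (∑ y, p t y * ∑ l, s t y l ^ 2) + 8 * ((m : ℝ) + 1) * ∑ y, p t y := by
          rw [mul_sum, mul_sum, ← sum_add_distrib]
          refine sum_congr rfl fun y _ => ?_
          ring
      _ ≤ _ := by
          rw [hsum t]
          linarith [hI t ht]
  have hR0 := hR t ht
  have hwpos : 0 ≤ ∑ y, p t y * ∑ l, ((1 - t l ^ 2) * s t y l - 2 * t l) ^ 2 :=
    sum_nonneg fun y _ => mul_nonneg (hpos t ht y) (sum_nonneg fun l _ => sq_nonneg _)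
  have hRpos : 0 ≤ ∑ y, p t y * ∑ l, (est y l - t l) ^ 2 :=
    sum_nonneg fun y _ => mul_nonneg (hpos t ht y) (sum_nonneg fun l _ => sq_nonneg _)
  calc (2 * ((m : ℝ) + 1) / 3) ^ 2 ≤ _ := pow_le_pow_left₀ (by positivity) (sub_nonneg.1 hdiv) 2
    _ ≤ _ := hcs
    _ ≤ _ := mul_le_mul hR0 hw hwpos (hRpos.trans hR0)

/-! ### Fisher information carried by one node -/

section Kernel

variable {X Y ι : Type} [Fintype X] {n : ℕ}

/-- The factor of node `j` in the law of the transcript when its sample has distribution `μ`. -/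
def avg (μ : X → ℝ) (q : Fin n → X → Y → ℝ) (j : Fin n) (y : Y) : ℝ :=
  ∑ x, μ x * q j x y

/-- The conditional expectation of the score of node `j` given the transcript. -/
def condScore (μ : X → ℝ) (S : X → ι → ℝ) (q : Fin n → X → Y → ℝ) (j : Fin n) (y : Y) (i : ι) : ℝ :=
  (∑ x, μ x * S x i * q j x y) / avg μ q j y

theorem prod_avg_eq (μ : X → ℝ) (q : Fin n → X → Y → ℝ) (j : Fin n) (y : Y) :
    ∏ r, avg μ q r y = avg μ q j y * ∏ r ∈ univ.erase j, avg μ q r y :=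
  (mul_prod_erase univ _ (mem_univ j)).symm

variable [Fintype Y]

/-- Expanding the product of sums over all sample tuples lets the sum over transcripts be done
first, where it is the constant `c`. Different choices of `ψ` yield all the mass and moment
identities below. -/
theorem sum_prod_sum (q : Fin n → X → Y → ℝ) (c : ℝ)
    (hq : ∀ x : Fin n → X, ∑ y, ∏ j, q j (x j) y = c) (ψ : Fin n → X → ℝ) :
    ∑ y, ∏ j, ∑ x, ψ j x * q j x y = c * ∏ j, ∑ x, ψ j x := by
  classical
  simp only [prod_univ_sum, Fintype.piFinset_univ, prod_mul_distrib]
  rw [sum_comm, mul_sum]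
  refine sum_congr rfl fun x _ => ?_
  rw [← mul_sum, hq, mul_comm]

variable {μ : X → ℝ} {S : X → ι → ℝ} {q : Fin n → X → Y → ℝ} {B : ℝ}

theorem avg_nonneg (hμ : ∀ x, 0 ≤ μ x) (hq : IsKernel q B) (j : Fin n) (y : Y) :
    0 ≤ avg μ q j y :=
  sum_nonneg fun x _ => mul_nonneg (hμ x) (hq.nonneg j x y)

theorem sum_mul_eq_zero_of_avg_eq_zero (hμ : ∀ x, 0 ≤ μ x) (hq : IsKernel q B) {j : Fin n} {y : Y}
    (h : avg μ q j y = 0) (f : X → ℝ) : ∑ x, μ x * f x * q j x y = 0 := by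
  refine sum_eq_zero fun x _ => ?_
  have := (sum_eq_zero_iff_of_nonneg fun x _ => mul_nonneg (hμ x) (hq.nonneg j x y)).1 h x
    (mem_univ x)
  rw [mul_right_comm, this, zero_mul]

/-- Clearing the denominator is harmless even when it vanishes: nonnegativity then makes every
summand of the numerator zero too. -/
theorem avg_mul_condScore (hμ : ∀ x, 0 ≤ μ x) (hq : IsKernel q B) (j : Fin n) (y : Y) (i : ι) :
    avg μ q j y * condScore μ S q j y i = ∑ x, μ x * S x i * q j x y := by
  by_cases h : avg μ q j y = 0
  · rw [h, zero_mul, sum_mul_eq_zero_of_avg_eq_zero hμ hq h]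
  · rw [condScore, mul_div_cancel₀ _ h]

theorem sum_prod_avg (hq : IsKernel q B) (hμ1 : ∑ x, μ x = 1) : ∑ y, ∏ j, avg μ q j y = 1 := by
  have h := sum_prod_sum q 1 hq.sum_prod fun _ => μ
  simpa [hμ1, avg] using h

theorem sum_prod_erase_avg (hq : IsKernel q B) (hμ1 : ∑ x, μ x = 1) (j : Fin n) :
    ∑ y, ∏ i ∈ univ.erase j, avg μ q i y = B := by
  -- The factor of node `j` is set to one, which turns the erased product into a full one.
  have h := sum_prod_sum (fun i x y => if i = j then 1 else q i x y) B (fun x => by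
    rw [← hq.sum_prod_erase j x]
    refine sum_congr rfl fun y _ => ?_
    rw [← mul_prod_erase univ _ (mem_univ j), if_pos rfl, one_mul]
    exact prod_congr rfl fun i hi => if_neg (ne_of_mem_erase hi)) fun _ => μ
  rw [prod_congr rfl fun _ _ => hμ1, prod_const_one, mul_one] at h
  rw [← h]
  refine sum_congr rfl fun y _ => ?_
  rw [← mul_prod_erase univ _ (mem_univ j)]
  simp only [if_true, mul_one, hμ1, one_mul]
  exact prod_congr rfl fun i hi => by simp [avg, ne_of_mem_erase hi]

theorem sum_mul_prod_erase_avg (hq : IsKernel q B) (hμ1 : ∑ x, μ x = 1) (j : Fin n)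
    (f : X → ℝ) :
    ∑ y, (∑ x, f x * q j x y) * ∏ i ∈ univ.erase j, avg μ q i y = ∑ x, f x := by
  have h := sum_prod_sum q 1 hq.sum_prod fun i => if i = j then f else μ
  rw [one_mul, ← mul_prod_erase univ _ (mem_univ j), if_pos rfl,
    prod_congr rfl fun i hi => by rw [if_neg (ne_of_mem_erase hi), hμ1], prod_const_one,
    mul_one] at h
  rw [← h]
  refine sum_congr rfl fun y _ => ?_
  rw [← mul_prod_erase univ _ (mem_univ j), if_pos rfl]
  congr 1
  exact prod_congr rfl fun i hi => by rw [if_neg (ne_of_mem_erase hi), avg]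

/-- The conditional scores of two different nodes are uncorrelated, because the samples are
conditionally independent given the transcript. -/
theorem sum_prod_avg_mul_condScore_mul (hμ : ∀ x, 0 ≤ μ x) (hq : IsKernel q B) (i : ι)
    (hS : ∑ x, μ x * S x i = 0) {j l : Fin n} (hjl : j ≠ l) :
    ∑ y, (∏ r, avg μ q r y) * (condScore μ S q j y i * condScore μ S q l y i) = 0 := by
  -- The score is inserted at nodes `j` and `l` only. As `j ≠ l`, the factor at `j` on the right is
  -- the mean of the score, which is zero.
  have h := sum_prod_sum q 1 hq.sum_prod fun r x =>
    μ x * ((if r = j then S x i else 1) * (if r = l then S x i else 1))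
  rw [prod_eq_zero (mem_univ j) (by simpa [hjl] using hS), mul_zero] at h
  rw [← h]
  refine sum_congr rfl fun y _ => ?_
  have key : ∀ r, ∑ x, μ x * ((if r = j then S x i else 1) * (if r = l then S x i else 1)) * q r x y
      = avg μ q r y * ((if r = j then condScore μ S q r y i else 1)
        * (if r = l then condScore μ S q r y i else 1)) := by
    intro r
    by_cases h1 : r = j
    · subst h1
      simp [hjl, avg_mul_condScore hμ hq]
    · by_cases h2 : r = l
      · subst h2
        simp [h1, avg_mul_condScore hμ hq]
      · simp [h1, h2, avg]
  rw [prod_congr rfl fun r _ => key r]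
  rw [prod_mul_distrib, prod_mul_distrib]
  simp only [prod_ite_eq', mem_univ, if_true]

variable [Fintype ι]

/-- Expanding the square, only the diagonal terms survive, since scores of distinct nodes are
uncorrelated. -/
theorem trace_fisher_eq (hμ : ∀ x, 0 ≤ μ x) (hq : IsKernel q B)
    (hS : ∀ i, ∑ x, μ x * S x i = 0) :
    ∑ y, (∏ r, avg μ q r y) * ∑ i, (∑ j, condScore μ S q j y i) ^ 2
      = ∑ j, ∑ y, (∏ r, avg μ q r y) * ∑ i, condScore μ S q j y i ^ 2 := by
  have h : ∀ i, ∑ y, (∏ r, avg μ q r y) * (∑ j, condScore μ S q j y i) ^ 2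
      = ∑ j, ∑ y, (∏ r, avg μ q r y) * condScore μ S q j y i ^ 2 := by
    intro i
    have e : ∀ y, (∏ r, avg μ q r y) * (∑ j, condScore μ S q j y i) ^ 2
        = ∑ j, ∑ l, (∏ r, avg μ q r y) * (condScore μ S q j y i * condScore μ S q l y i) := by
      intro y
      rw [sq, sum_mul_sum]
      simp only [mul_sum]
    rw [sum_congr rfl fun y _ => e y, sum_comm]
    refine sum_congr rfl fun j _ => ?_
    simp only [sq]
    rw [sum_comm, sum_eq_single j]
    · exact fun l _ hl => sum_prod_avg_mul_condScore_mul hμ hq i (hS i) hl.symm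
    · simp
  simp only [mul_sum]
  rw [sum_comm]
  simp only [h]
  rw [sum_comm]
  refine sum_congr rfl fun j _ => sum_comm

theorem prod_erase_avg_nonneg (hμ : ∀ x, 0 ≤ μ x) (hq : IsKernel q B) (j : Fin n) (y : Y) :
    0 ≤ ∏ r ∈ univ.erase j, avg μ q r y :=
  prod_nonneg fun r _ => avg_nonneg hμ hq r y

/-- The conditional score carries at most the Fisher information of one sample. -/
theorem sum_condScore_sq_le_trace (hμ : ∀ x, 0 ≤ μ x) (hμ1 : ∑ x, μ x = 1) (hq : IsKernel q B)
    (j : Fin n) :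
    ∑ y, (∏ r, avg μ q r y) * ∑ i, condScore μ S q j y i ^ 2 ≤ ∑ x, μ x * ∑ i, S x i ^ 2 := by
  rw [← sum_mul_prod_erase_avg hq hμ1 j]
  refine sum_le_sum fun y _ => ?_
  rw [prod_avg_eq _ q j, mul_right_comm]
  refine mul_le_mul_of_nonneg_right ?_ (prod_erase_avg_nonneg hμ hq j y)
  have h : ∀ i, avg μ q j y * condScore μ S q j y i ^ 2 ≤ ∑ x, μ x * S x i ^ 2 * q j x y := by
    intro i
    -- Cauchy–Schwarz with weights `μ x * q j x y`: conditioning on the transcript does not increase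
    -- the second moment.
    have h1 := sum_mul_sq_le_sq_mul_sq univ (fun x => √(μ x * q j x y))
      (fun x => √(μ x * q j x y) * S x i)
    have h0 : ∀ x, 0 ≤ μ x * q j x y := fun x => mul_nonneg (hμ x) (hq.nonneg j x y)
    simp only [mul_pow, Real.sq_sqrt (h0 _), ← mul_assoc, Real.mul_self_sqrt (h0 _)] at h1
    have e1 : ∑ x, μ x * q j x y * S x i = avg μ q j y * condScore μ S q j y i := by
      rw [avg_mul_condScore hμ hq]
      exact sum_congr rfl fun x _ => by ring
    have e2 : ∑ x, μ x * q j x y * S x i ^ 2 = ∑ x, μ x * S x i ^ 2 * q j x y :=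
      sum_congr rfl fun x _ => by ring
    rw [e1, e2] at h1
    have hA := avg_nonneg hμ hq j y
    rcases hA.eq_or_lt with hA0 | hA0
    · rw [← hA0, zero_mul]
      exact sum_nonneg fun x _ => mul_nonneg (mul_nonneg (hμ x) (sq_nonneg _)) (hq.nonneg j x y)
    · refine le_of_mul_le_mul_left ?_ hA0
      calc _ = (avg μ q j y * condScore μ S q j y i) ^ 2 := by ring
        _ ≤ _ := h1
  rw [mul_sum]
  refine (sum_le_sum fun i _ => h i).trans (le_of_eq ?_)
  rw [sum_comm]
  refine sum_congr rfl fun x _ => ?_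
  rw [mul_sum, sum_mul]

/-- If the Fisher information matrix of one sample is at most `K`, then the conditional score given
a transcript with removal mass `B` carries information at most `K * B`. -/
theorem sum_condScore_sq_le_mul (hμ : ∀ x, 0 ≤ μ x) (hμ1 : ∑ x, μ x = 1) (hq : IsKernel q B)
    {K : ℝ} (hK : 0 ≤ K)
    (hvar : ∀ u : ι → ℝ, ∑ x, μ x * (∑ i, u i * S x i) ^ 2 ≤ K * ∑ i, u i ^ 2) (j : Fin n) :
    ∑ y, (∏ r, avg μ q r y) * ∑ i, condScore μ S q j y i ^ 2 ≤ K * B := by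
  rw [← sum_prod_erase_avg hq hμ1 j, mul_sum]
  refine sum_le_sum fun y _ => ?_
  rw [prod_avg_eq _ q j, mul_right_comm]
  refine mul_le_mul_of_nonneg_right ?_ (prod_erase_avg_nonneg hμ hq j y)
  set a := condScore μ S q j y
  set N := ∑ i, a i ^ 2
  have hN : 0 ≤ N := sum_nonneg fun i _ => sq_nonneg _
  have h0 : ∀ x, 0 ≤ μ x * q j x y := fun x => mul_nonneg (hμ x) (hq.nonneg j x y)
  -- The score is tested in the direction of the conditional score `a` itself. With `q ≤ 1` this
  -- gives `(avg * N)² ≤ avg * K * N`, hence `avg * N ≤ K` for each transcript; the erased products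
  -- then sum to `B`.
  have h1 := sum_mul_sq_le_sq_mul_sq univ (fun x => √(μ x * q j x y))
    (fun x => √(μ x * q j x y) * ∑ i, a i * S x i)
  simp only [mul_pow, Real.sq_sqrt (h0 _), ← mul_assoc, Real.mul_self_sqrt (h0 _)] at h1
  have e1 : ∑ x, μ x * q j x y * ∑ i, a i * S x i = avg μ q j y * N := by
    simp only [N, mul_sum]
    rw [sum_comm]
    refine sum_congr rfl fun i _ => ?_
    rw [sq, ← mul_assoc, avg_mul_condScore hμ hq, sum_mul]
    exact sum_congr rfl fun x _ => by ring
  have e2 : ∑ x, μ x * q j x y * (∑ i, a i * S x i) ^ 2 ≤ K * N :=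
    (sum_le_sum fun x _ => mul_le_mul_of_nonneg_right
      (mul_le_of_le_one_right (hμ x) (hq.le_one j x y)) (sq_nonneg _)).trans (hvar a)
  have hA := avg_nonneg hμ hq j y
  rw [e1] at h1
  have h2 : (avg μ q j y * N) ^ 2 ≤ avg μ q j y * (K * N) :=
    h1.trans (mul_le_mul_of_nonneg_left e2 hA)
  rcases (mul_nonneg hA hN).eq_or_lt with h3 | h3
  · rw [← h3]
    exact hK
  · refine le_of_mul_le_mul_left ?_ h3
    calc _ = (avg μ q j y * N) ^ 2 := by ring
      _ ≤ _ := h2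
      _ = _ := by ring

/-- If the score of one sample is sub-Gaussian, then the conditional score given a transcript with
removal mass `B` carries information at most `2 * log B`. -/
theorem sum_condScore_sq_le_log (hμ : ∀ x, 0 ≤ μ x) (hμ1 : ∑ x, μ x = 1) (hq : IsKernel q B)
    (hsub : ∀ u : ι → ℝ,
      ∑ x, μ x * Real.exp (∑ i, u i * S x i) ≤ Real.exp ((∑ i, u i ^ 2) / 2)) (j : Fin n) :
    ∑ y, (∏ r, avg μ q r y) * ∑ i, condScore μ S q j y i ^ 2 ≤ 2 * Real.log B := by
  -- Jensen in the direction `a` gives `avg * exp N ≤ ∑ μ q exp⟨a, S⟩`; as `q ≤ 1`, the right side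
  -- is at most `exp (N / 2)`.
  have hbound : ∀ y, avg μ q j y * Real.exp ((∑ i, condScore μ S q j y i ^ 2) / 2) ≤ 1 := by
    intro y
    set a := condScore μ S q j y
    set N := ∑ i, a i ^ 2
    have h0 : ∀ x, 0 ≤ μ x * q j x y := fun x => mul_nonneg (hμ x) (hq.nonneg j x y)
    rcases (avg_nonneg hμ hq j y).eq_or_lt with hA | hA
    · rw [← hA, zero_mul]
      exact zero_le_one
    have hJ := convexOn_exp.map_sum_le (t := univ) (w := fun x => μ x * q j x y / avg μ q j y)
      (p := fun x => ∑ i, a i * S x i) (fun x _ => div_nonneg (h0 x) hA.le)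
      (by rw [← sum_div]; exact div_self hA.ne') (fun _ _ => Set.mem_univ _)
    have e1 : ∑ x, (μ x * q j x y / avg μ q j y) • ∑ i, a i * S x i = N := by
      have : ∑ x, μ x * q j x y * ∑ i, a i * S x i = avg μ q j y * N := by
        simp only [N, mul_sum]
        rw [sum_comm]
        refine sum_congr rfl fun i _ => ?_
        rw [sq, ← mul_assoc, avg_mul_condScore hμ hq, sum_mul]
        exact sum_congr rfl fun x _ => by ring
      simp only [smul_eq_mul, div_mul_eq_mul_div, ← sum_div]
      rw [this, mul_div_cancel_left₀ _ hA.ne']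
    rw [e1] at hJ
    simp only [smul_eq_mul, div_mul_eq_mul_div, ← sum_div] at hJ
    rw [le_div_iff₀ hA] at hJ
    have h2 : ∑ x, μ x * q j x y * Real.exp (∑ i, a i * S x i) ≤ Real.exp (N / 2) :=
      (sum_le_sum fun x _ => mul_le_mul_of_nonneg_right
        (mul_le_of_le_one_right (hμ x) (hq.le_one j x y)) (Real.exp_pos _).le).trans (hsub a)
    have h3 : Real.exp N = Real.exp (N / 2) * Real.exp (N / 2) := by
      rw [← Real.exp_add, add_halves]
    have h4 := hJ.trans h2
    rw [h3] at h4
    refine le_of_mul_le_mul_left ?_ (Real.exp_pos (N / 2))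
    linarith
  have hp0 : ∀ y, 0 ≤ ∏ r, avg μ q r y := fun y => prod_nonneg fun r _ => avg_nonneg hμ hq r y
  -- A second Jensen, now over transcripts: `exp (𝔼 N / 2) ≤ 𝔼 exp (N / 2) ≤ B`, where `hbound`
  -- cancels the factor of node `j`.
  have hJ := convexOn_exp.map_sum_le (t := univ) (w := fun y => ∏ r, avg μ q r y)
    (p := fun y => (∑ i, condScore μ S q j y i ^ 2) / 2) (fun y _ => hp0 y)
    (sum_prod_avg hq hμ1) (fun _ _ => Set.mem_univ _)
  have h1 : ∑ y, (∏ r, avg μ q r y) • Real.exp ((∑ i, condScore μ S q j y i ^ 2) / 2) ≤ B := by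
    rw [← sum_prod_erase_avg hq hμ1 j]
    refine sum_le_sum fun y _ => ?_
    rw [prod_avg_eq _ q j, smul_eq_mul, mul_right_comm]
    exact mul_le_of_le_one_left (prod_erase_avg_nonneg hμ hq j y) (hbound y)
  have h2 := (Real.le_log_iff_exp_le ((Real.exp_pos _).trans_le (hJ.trans h1))).2 (hJ.trans h1)
  simp only [smul_eq_mul, ← mul_div_assoc, ← sum_div] at h2
  linarith

/-- The quadratic form is tested on the standard basis vectors. -/
theorem trace_le_of_variance_le {K : ℝ}
    (hvar : ∀ u : ι → ℝ, ∑ x, μ x * (∑ i, u i * S x i) ^ 2 ≤ K * ∑ i, u i ^ 2) :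
    ∑ x, μ x * ∑ i, S x i ^ 2 ≤ K * Fintype.card ι := by
  classical
  have h : ∀ i, ∑ x, μ x * S x i ^ 2 ≤ K := fun i => by
    simpa [Pi.single_apply] using hvar (Pi.single i 1)
  simp only [mul_sum]
  rw [sum_comm]
  refine (sum_le_sum fun i _ => h i).trans (le_of_eq ?_)
  simp [mul_comm]

end Kernel

/-- A lower bound for the risk of estimating a parameter in `[-1,1]^(m+1)` from transcripts, when
each node's message carries Fisher information at most `c`. -/
theorem transcript_vanTrees {m n : ℕ} {X Y : Type} [Fintype X] [Fintype Y]
    {q : Fin n → X → Y → ℝ} {B : ℝ} (hq : IsKernel q B)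
    (μ : (Fin (m + 1) → ℝ) → X → ℝ) (S : (Fin (m + 1) → ℝ) → X → Fin (m + 1) → ℝ)
    (hμd : ∀ x, ContDiff ℝ 1 fun t => μ t x) (hμ1 : ∀ t, ∑ x, μ t x = 1)
    (hμ : ∀ t, (∀ l, t l ∈ Set.Icc (-1 : ℝ) 1) → ∀ x, 0 ≤ μ t x)
    (hS : ∀ t, (∀ l, t l ∈ Set.Icc (-1 : ℝ) 1) → ∀ x l,
      fderiv ℝ (fun t => μ t x) t (Pi.single l 1) = μ t x * S t x l)
    (c : ℝ) (hc : ∀ t, (∀ l, t l ∈ Set.Icc (-1 : ℝ) 1) → ∀ j,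
      ∑ y, (∏ r, avg (μ t) q r y) * ∑ i, condScore (μ t) (S t) q j y i ^ 2 ≤ c)
    (est : Y → Fin (m + 1) → ℝ) (R : ℝ)
    (hR : ∀ t, (∀ l, t l ∈ Set.Icc (-1 : ℝ) 1) →
      ∑ y, (∏ r, avg (μ t) q r y) * ∑ l, (est y l - t l) ^ 2 ≤ R) :
    (2 * ((m : ℝ) + 1) / 3) ^ 2 ≤ R * (2 * (n * c) + 8 * ((m : ℝ) + 1)) := by
  have havg : ∀ r y, ContDiff ℝ 1 fun t => avg (μ t) q r y := fun r y =>
    ContDiff.sum fun x _ => (hμd x).mul contDiff_const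
  have hzero : ∀ t, (∀ l, t l ∈ Set.Icc (-1 : ℝ) 1) → ∀ l, ∑ x, μ t x * S t x l = 0 := by
    intro t ht l
    have h1 : HasFDerivAt (fun t => ∑ x, μ t x) (∑ x, fderiv ℝ (fun t => μ t x) t) t :=
      HasFDerivAt.fun_sum fun x _ => ((hμd x).differentiable one_ne_zero t).hasFDerivAt
    have h2 : HasFDerivAt (fun t => ∑ x, μ t x) (0 : (Fin (m + 1) → ℝ) →L[ℝ] ℝ) t := by
      simp only [hμ1]
      exact hasFDerivAt_const _ _
    have h3 := congrArg (fun L => L (Pi.single l (1 : ℝ))) (h1.unique h2)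
    simpa [hS t ht] using h3
  refine vanTrees (fun t y => ∏ r, avg (μ t) q r y)
    (fun t y l => ∑ j, condScore (μ t) (S t) q j y l) est (n * c) R
    (fun y => contDiff_prod fun r _ => havg r y) (fun t => sum_prod_avg hq (hμ1 t))
    (fun t ht y => prod_nonneg fun r _ => avg_nonneg (hμ t ht) hq r y) ?_ ?_ hR
  · intro t ht y l
    have hd : ∀ r, HasFDerivAt (fun t => avg (μ t) q r y)
        (∑ x, q r x y • fderiv ℝ (fun t => μ t x) t) t := fun r =>
      HasFDerivAt.fun_sum fun x _ =>
        ((hμd x).differentiable one_ne_zero t).hasFDerivAt.mul_const (q r x y)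
    have h := HasFDerivAt.finsetProd (u := univ) fun r _ => hd r
    rw [h.fderiv]
    simp only [_root_.sum_apply, _root_.smul_apply, smul_eq_mul, hS t ht]
    rw [mul_sum]
    refine sum_congr rfl fun j _ => ?_
    rw [prod_avg_eq _ q j, mul_right_comm, avg_mul_condScore (hμ t ht) hq, mul_comm]
    congr 1
    exact sum_congr rfl fun x _ => by ring
  · intro t ht
    rw [trace_fisher_eq (hμ t ht) hq (hzero t ht)]
    refine (sum_le_sum fun j _ => hc t ht j).trans (le_of_eq ?_)
    simp

/-! ### Scores of product Bernoulli distributions -/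

/-- The score `(a - v) / (v (1 - v))` of the Bernoulli distribution with mean `v`. -/
def bernScore (v : ℝ) (a : Bool) : ℝ := if a then v⁻¹ else -(1 - v)⁻¹

theorem sum_bernMass_mul_prod {d : ℕ} (θ : EuclideanSpace ℝ (Fin d)) (f : Fin d → Bool → ℝ) :
    ∑ x, bernMass θ x * ∏ i, f i (x i) = ∏ i, (θ i * f i true + (1 - θ i) * f i false) := by
  have h : ∀ i, θ i * f i true + (1 - θ i) * f i false
      = ∑ a : Bool, (if a then θ i else 1 - θ i) * f i a := fun i => by simp
  rw [prod_congr rfl fun i _ => h i, prod_univ_sum, Fintype.piFinset_univ]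
  exact sum_congr rfl fun x _ => by rw [prod_mul_distrib, bernMass]

theorem sum_bernMass {d : ℕ} (θ : EuclideanSpace ℝ (Fin d)) : ∑ x, bernMass θ x = 1 := by
  simpa using sum_bernMass_mul_prod θ fun _ _ => 1

theorem bernMass_nonneg {d : ℕ} {θ : EuclideanSpace ℝ (Fin d)}
    (h : ∀ i, θ i ∈ Set.Icc (0 : ℝ) 1) (x : Sample d) : 0 ≤ bernMass θ x :=
  prod_nonneg fun i _ => by
    have := h i
    split_ifs
    · exact this.1
    · exact sub_nonneg.2 this.2

/-- The coordinate scores are independent and centered, with variance `(θ i)⁻¹ + (1 - θ i)⁻¹`. -/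
theorem sum_bernMass_mul_sq {d : ℕ} {θ : EuclideanSpace ℝ (Fin d)}
    (h : ∀ i, θ i ∈ Set.Ioo (0 : ℝ) 1) (w : Fin d → ℝ) :
    ∑ x, bernMass θ x * (∑ i, w i * bernScore (θ i) (x i)) ^ 2
      = ∑ i, w i ^ 2 * ((θ i)⁻¹ + (1 - θ i)⁻¹) := by
  have hv : ∀ i, θ i ≠ 0 ∧ 1 - θ i ≠ 0 := fun i => ⟨(h i).1.ne', (sub_pos.2 (h i).2).ne'⟩
  have key : ∀ i j, ∑ x, bernMass θ x * (bernScore (θ i) (x i) * bernScore (θ j) (x j))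
      = if j = i then (θ i)⁻¹ + (1 - θ i)⁻¹ else 0 := by
    intro i j
    have hp := sum_bernMass_mul_prod θ fun r a =>
      (if r = i then bernScore (θ r) a else 1) * (if r = j then bernScore (θ r) a else 1)
    have hl : ∀ x : Sample d, ∏ r, ((if r = i then bernScore (θ r) (x r) else 1)
        * (if r = j then bernScore (θ r) (x r) else 1))
        = bernScore (θ i) (x i) * bernScore (θ j) (x j) := by
      intro x
      rw [prod_mul_distrib]
      simp only [prod_ite_eq', mem_univ, if_true]
    simp only [hl] at hp
    rw [hp]
    have := hv i
    split_ifs with hij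
    · subst hij
      rw [prod_eq_single j]
      · simp only [if_true, bernScore]
        simp only [Bool.false_eq_true, if_false]
        field_simp
      · intro r _ hr
        simp [hr]
      · simp
    · refine prod_eq_zero (mem_univ i) ?_
      simp [Ne.symm hij, bernScore, mul_inv_cancel₀ this.1, mul_inv_cancel₀ this.2]
  have e : ∀ x : Sample d, bernMass θ x * (∑ i, w i * bernScore (θ i) (x i)) ^ 2
      = ∑ i, ∑ j, w i * w j *
        (bernMass θ x * (bernScore (θ i) (x i) * bernScore (θ j) (x j))) := by
    intro x
    rw [sq, sum_mul_sum]
    simp only [mul_sum]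
    exact sum_congr rfl fun i _ => sum_congr rfl fun j _ => by ring
  rw [sum_congr rfl fun x _ => e x, sum_comm]
  refine sum_congr rfl fun i _ => ?_
  rw [sum_comm]
  simp only [← mul_sum, key]
  simp [sq]

/-- Hoeffding's lemma for the score of a Bernoulli distribution. -/
theorem bernScore_subgaussian {v M : ℝ} (hv : v ∈ Set.Ioo (0 : ℝ) 1) (h0 : v⁻¹ ≤ M)
    (h1 : (1 - v)⁻¹ ≤ M) (w : ℝ) :
    v * Real.exp (w * bernScore v true) + (1 - v) * Real.exp (w * bernScore v false)
      ≤ Real.exp ((w * M) ^ 2 / 2) := by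
  have hv0 : v ≠ 0 := hv.1.ne'
  have hv1 : 0 < 1 - v := sub_pos.2 hv.2
  have hM : 0 < M := (inv_pos.2 hv.1).trans_le h0
  -- The exponential lies below its chord on `[-M, M]`. After averaging, the terms linear in `s`
  -- cancel because the score is centered, which leaves `cosh (w * M)`.
  have hconv : ∀ s : ℝ, -M ≤ s → s ≤ M → Real.exp (w * s)
      ≤ (1 + s / M) / 2 * Real.exp (w * M) + (1 - s / M) / 2 * Real.exp (-(w * M)) := by
    intro s hs1 hs2
    have ha : -1 ≤ s / M := by rw [le_div_iff₀ hM]; linarith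
    have hb : s / M ≤ 1 := by rw [div_le_iff₀ hM]; linarith
    have h := convexOn_exp.2 (Set.mem_univ (w * M)) (Set.mem_univ (-(w * M)))
      (show 0 ≤ (1 + s / M) / 2 by linarith) (show 0 ≤ (1 - s / M) / 2 by linarith) (by ring)
    simp only [smul_eq_mul] at h
    refine le_of_eq_of_le (congrArg Real.exp ?_) h
    field_simp
    ring
  have hp : 0 ≤ v⁻¹ := inv_nonneg.2 hv.1.le
  have hq : 0 ≤ (1 - v)⁻¹ := inv_nonneg.2 hv1.le
  have ht := mul_le_mul_of_nonneg_left (hconv v⁻¹ (by linarith) h0) hv.1.le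
  have hf := mul_le_mul_of_nonneg_left (hconv (-(1 - v)⁻¹) (by linarith) (by linarith)) hv1.le
  simp only [bernScore, if_true, Bool.false_eq_true, if_false]
  refine (add_le_add ht hf).trans ?_
  refine le_trans (le_of_eq ?_) (Real.cosh_le_exp_half_sq (w * M))
  rw [Real.cosh_eq]
  have hv1' := hv1.ne'
  field_simp
  ring

theorem sum_bernMass_mul_exp_le {d : ℕ} {θ : EuclideanSpace ℝ (Fin d)} {M : ℝ}
    (h : ∀ i, θ i ∈ Set.Ioo (0 : ℝ) 1) (h0 : ∀ i, (θ i)⁻¹ ≤ M) (h1 : ∀ i, (1 - θ i)⁻¹ ≤ M)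
    (w : Fin d → ℝ) :
    ∑ x, bernMass θ x * Real.exp (∑ i, w i * bernScore (θ i) (x i))
      ≤ Real.exp ((∑ i, (w i * M) ^ 2) / 2) := by
  simp only [Real.exp_sum, sum_div]
  rw [sum_bernMass_mul_prod θ fun i a => Real.exp (w i * bernScore (θ i) a)]
  refine prod_le_prod (fun i _ => ?_) fun i _ => bernScore_subgaussian (h i) (h0 i) (h1 i) (w i)
  exact add_nonneg (mul_nonneg (h i).1.le (Real.exp_pos _).le)
    (mul_nonneg (sub_nonneg.2 (h i).2.le) (Real.exp_pos _).le)

/-! ### Affine families and reduction of the worst-case risk -/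

/-- The affine family of parameters `c + A t`. -/
def affineParam {d D : ℕ} (c : ℝ) (A : Fin d → Fin D → ℝ) (t : Fin D → ℝ) :
    EuclideanSpace ℝ (Fin d) :=
  WithLp.toLp 2 fun i => c + ∑ l, A i l * t l

/-- The score of the family of product Bernoulli distributions with parameter `c + A t`. -/
def affineScore {d D : ℕ} (c : ℝ) (A : Fin d → Fin D → ℝ) (t : Fin D → ℝ) (x : Sample d)
    (l : Fin D) : ℝ :=
  ∑ i, A i l * bernScore (affineParam c A t i) (x i)

theorem hasFDerivAt_affineParam {d D : ℕ} (c : ℝ) (A : Fin d → Fin D → ℝ) (i : Fin d)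
    (t : Fin D → ℝ) :
    HasFDerivAt (fun t => affineParam c A t i)
      (∑ l, A i l • ContinuousLinearMap.proj (R := ℝ) (φ := fun _ : Fin D => ℝ) l) t := by
  have h : HasFDerivAt (fun t : Fin D → ℝ => ∑ l, A i l * t l)
      (∑ l, A i l • ContinuousLinearMap.proj (R := ℝ) (φ := fun _ : Fin D => ℝ) l) t :=
    HasFDerivAt.fun_sum fun l _ => HasFDerivAt.const_mul (hasFDerivAt_apply l t) (A i l)
  exact h.const_add c

theorem contDiff_affineParam {d D : ℕ} (c : ℝ) (A : Fin d → Fin D → ℝ) (i : Fin d) :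
    ContDiff ℝ 1 fun t => affineParam c A t i := by
  change ContDiff ℝ 1 fun t : Fin D → ℝ => c + ∑ l, A i l * t l
  fun_prop

theorem contDiff_bernMass_affineParam {d D : ℕ} (c : ℝ) (A : Fin d → Fin D → ℝ) (x : Sample d) :
    ContDiff ℝ 1 fun t => bernMass (affineParam c A t) x := by
  refine contDiff_prod fun i _ => ?_
  have := contDiff_affineParam c A i
  split_ifs
  · exact this
  · exact contDiff_const.sub this

theorem fderiv_bernMass_affineParam {d D : ℕ} (c : ℝ) (A : Fin d → Fin D → ℝ) {t : Fin D → ℝ}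
    (h : ∀ i, affineParam c A t i ∈ Set.Ioo (0 : ℝ) 1) (x : Sample d) (l : Fin D) :
    fderiv ℝ (fun t => bernMass (affineParam c A t) x) t (Pi.single l 1)
      = bernMass (affineParam c A t) x * affineScore c A t x l := by
  have hd : ∀ i, HasFDerivAt
      (fun t => if x i then affineParam c A t i else 1 - affineParam c A t i)
      ((if x i then (1 : ℝ) else -1) •
        ∑ l, A i l • ContinuousLinearMap.proj (R := ℝ) (φ := fun _ : Fin D => ℝ) l) t := by
    intro i
    have := hasFDerivAt_affineParam c A i t
    by_cases hx : x i
    · simpa [hx] using this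
    · simp only [hx, Bool.false_eq_true, if_false]
      exact (this.const_sub 1).congr_fderiv (by ext; simp)
  have hD : HasFDerivAt (fun t => bernMass (affineParam c A t) x) _ t :=
    HasFDerivAt.finsetProd (u := univ) fun i _ => hd i
  rw [hD.fderiv, affineScore, mul_sum]
  simp only [_root_.sum_apply, _root_.smul_apply, smul_eq_mul, ContinuousLinearMap.proj_apply,
    Pi.single_apply, mul_ite, mul_one, mul_zero, sum_ite_eq', mem_univ, if_true]
  refine sum_congr rfl fun i _ => ?_
  rw [bernMass, ← mul_prod_erase univ _ (mem_univ i)]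
  have h0 := (h i).1.ne'
  have h1 := (sub_pos.2 (h i).2).ne'
  by_cases hx : x i
  · simp only [hx, if_true, bernScore]
    field_simp
  · simp only [hx, bernScore, Bool.false_eq_true, if_false]
    field_simp

theorem sum_mul_affineScore {d D : ℕ} (c : ℝ) (A : Fin d → Fin D → ℝ) (t : Fin D → ℝ)
    (x : Sample d) (u : Fin D → ℝ) :
    ∑ l, u l * affineScore c A t x l
      = ∑ i, (∑ l, A i l * u l) * bernScore (affineParam c A t i) (x i) := by
  simp only [affineScore, mul_sum, sum_mul]
  rw [sum_comm]
  exact sum_congr rfl fun i _ => sum_congr rfl fun l _ => by ring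

theorem risk_eq_sum_avg {d n : ℕ} {Y : Type} [Fintype Y] (q : Fin n → Sample d → Y → ℝ)
    (est : Y → EuclideanSpace ℝ (Fin d)) (θ : EuclideanSpace ℝ (Fin d)) :
    risk (fun x y => ∏ j, q j (x j) y) est θ
      = ∑ y, (∏ r, avg (bernMass θ) q r y) * ‖est y - θ‖ ^ 2 := by
  simp only [risk, mul_sum]
  rw [sum_comm]
  refine sum_congr rfl fun y _ => ?_
  simp only [avg, prod_univ_sum, Fintype.piFinset_univ, sum_mul]
  refine sum_congr rfl fun x _ => ?_
  rw [prod_mul_distrib, iidMass, mul_assoc]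

theorem isCompact_cube (d : ℕ) : IsCompact (cube d) := by
  have h : IsCompact (Set.univ.pi fun _ : Fin d => Set.Icc (0 : ℝ) 1) :=
    isCompact_univ_pi fun _ => isCompact_Icc
  have h2 := (EuclideanSpace.equiv (Fin d) ℝ).toHomeomorph.isCompact_preimage.2 h
  convert h2 using 1
  ext θ
  simp only [cube, Set.mem_preimage, Set.mem_univ_pi]
  rfl

theorem continuous_risk {n d : ℕ} {Y : Type} [Fintype Y] (law : (Fin n → Sample d) → Y → ℝ)
    (est : Y → EuclideanSpace ℝ (Fin d)) : Continuous (risk law est) := by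
  refine continuous_finsetSum _ fun x _ => Continuous.mul ?_ ?_
  · refine continuous_finsetProd _ fun j _ => continuous_finsetProd _ fun i _ => ?_
    split_ifs <;> fun_prop
  · fun_prop

/-- Continuity of the risk on the compact cube bounds it above, so the supremum is genuine and not
the default value of an unbounded `⨆`. -/
theorem risk_le_worstRisk {n d : ℕ} {Y : Type} [Fintype Y] (law : (Fin n → Sample d) → Y → ℝ)
    (est : Y → EuclideanSpace ℝ (Fin d)) {Θ : Set (EuclideanSpace ℝ (Fin d))} (hΘ : Θ ⊆ cube d)
    {θ : EuclideanSpace ℝ (Fin d)} (hθ : θ ∈ Θ) : risk law est θ ≤ worstRisk law est Θ := by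
  obtain ⟨b, hb⟩ := (isCompact_cube d).bddAbove_image (continuous_risk law est).continuousOn
  refine le_ciSup (f := fun θ : Θ => risk law est (θ : EuclideanSpace ℝ (Fin d))) ⟨b, ?_⟩ ⟨θ, hθ⟩
  rintro _ ⟨θ', rfl⟩
  exact hb ⟨θ', hΘ θ'.2, rfl⟩

theorem riskAtLeast_of_isKernel {n k d : ℕ} {Θ : Set (EuclideanSpace ℝ (Fin d))} {r : ℝ}
    (h : ∀ {Y : Type} [Fintype Y] (q : Fin n → Sample d → Y → ℝ), IsKernel q (2 ^ k) →
      ∀ est : Y → EuclideanSpace ℝ (Fin d),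
        r ≤ worstRisk (fun x y => ∏ j, q j (x j) y) est Θ) : RiskAtLeast n k d Θ r := by
  refine ⟨fun P est => h _ P.toSeq.isKernel_factor est, fun P est => h _ P.isKernel_factor est,
    fun P est => ?_⟩
  have := h _ P.isKernel_factor est
  simpa only [P.prod_factor] using this

/-- The lower bound for the worst-case risk along an affine family of parameters `c + A t` with
`t ∈ [-1,1]^(m+1)`, where the transcript kernel carries Fisher information at most `I` per node and
an estimator of the full parameter is converted to one of `t` with loss factor `ρ`. -/
theorem affine_vanTrees {n d m : ℕ} {Y : Type} [Fintype Y] {B : ℝ}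
    {q : Fin n → Sample d → Y → ℝ} (hq : IsKernel q B) (est : Y → EuclideanSpace ℝ (Fin d))
    {Θ : Set (EuclideanSpace ℝ (Fin d))} (hΘ : Θ ⊆ cube d) (c : ℝ)
    (A : Fin d → Fin (m + 1) → ℝ)
    (hmem : ∀ t, (∀ l, t l ∈ Set.Icc (-1 : ℝ) 1) → affineParam c A t ∈ Θ)
    (hIoo : ∀ t, (∀ l, t l ∈ Set.Icc (-1 : ℝ) 1) → ∀ i, affineParam c A t i ∈ Set.Ioo (0 : ℝ) 1)
    (I : ℝ) (hI : ∀ t, (∀ l, t l ∈ Set.Icc (-1 : ℝ) 1) → ∀ j,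
      ∑ y, (∏ r, avg (bernMass (affineParam c A t)) q r y)
        * ∑ i, condScore (bernMass (affineParam c A t)) (affineScore c A t) q j y i ^ 2 ≤ I)
    (est' : Y → Fin (m + 1) → ℝ) {ρ : ℝ} (hρ : 0 ≤ ρ)
    (hest : ∀ t y, ∑ l, (est' y l - t l) ^ 2 ≤ ρ * ‖est y - affineParam c A t‖ ^ 2) :
    (2 * ((m : ℝ) + 1) / 3) ^ 2 ≤ ρ * worstRisk (fun x y => ∏ j, q j (x j) y) est Θ
      * (2 * (n * I) + 8 * ((m : ℝ) + 1)) := by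
  have hnn : ∀ t, (∀ l, t l ∈ Set.Icc (-1 : ℝ) 1) → ∀ x, 0 ≤ bernMass (affineParam c A t) x :=
    fun t ht => bernMass_nonneg fun i => Set.Ioo_subset_Icc_self (hIoo t ht i)
  refine transcript_vanTrees hq (fun t => bernMass (affineParam c A t)) (affineScore c A)
    (contDiff_bernMass_affineParam c A) (fun t => sum_bernMass _) hnn
    (fun t ht x l => fderiv_bernMass_affineParam c A (hIoo t ht) x l) I hI est' _ fun t ht => ?_
  have h := risk_le_worstRisk (fun x y => ∏ j, q j (x j) y) est hΘ (hmem t ht)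
  rw [risk_eq_sum_avg] at h
  refine le_trans ?_ (mul_le_mul_of_nonneg_left h hρ)
  rw [mul_sum]
  refine sum_le_sum fun y _ => ?_
  rw [mul_left_comm]
  exact mul_le_mul_of_nonneg_left (hest t y)
    (prod_nonneg fun r _ => avg_nonneg (hnn t ht) hq r y)

/-- The variance bound for the score of an affine family. -/
theorem affineScore_variance_le {d D : ℕ} {c : ℝ} {A : Fin d → Fin D → ℝ} {t : Fin D → ℝ}
    (h : ∀ i, affineParam c A t i ∈ Set.Ioo (0 : ℝ) 1) {κ K : ℝ}
    (hκ : ∀ i, (affineParam c A t i)⁻¹ + (1 - affineParam c A t i)⁻¹ ≤ κ)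
    (hK : ∀ u : Fin D → ℝ, κ * ∑ i, (∑ l, A i l * u l) ^ 2 ≤ K * ∑ l, u l ^ 2)
    (u : Fin D → ℝ) :
    ∑ x, bernMass (affineParam c A t) x * (∑ l, u l * affineScore c A t x l) ^ 2
      ≤ K * ∑ l, u l ^ 2 := by
  simp only [sum_mul_affineScore]
  rw [sum_bernMass_mul_sq h]
  refine le_trans ?_ (hK u)
  rw [mul_sum]
  refine sum_le_sum fun i _ => ?_
  rw [mul_comm]
  exact mul_le_mul_of_nonneg_right (hκ i) (sq_nonneg _)

theorem inv_le_of_le_mul {v M : ℝ} (hv : 0 < v) (h : 1 ≤ M * v) : v⁻¹ ≤ M := by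
  rw [inv_le_iff_one_le_mul₀ hv]
  exact h

/-! ### The cube -/

/-- The matrix of the family of parameters filling a cube centered at `(1/2, …, 1/2)`. -/
def cubeMatrix (d : ℕ) (i l : Fin d) : ℝ := if i = l then 1 / 4 else 0

theorem sum_cubeMatrix_mul {d : ℕ} (u : Fin d → ℝ) (i : Fin d) :
    ∑ l, cubeMatrix d i l * u l = u i / 4 := by
  simp [cubeMatrix]
  ring

theorem worstRisk_cube_ge {n k m : ℕ} (hd : m + 1 ≤ n * min k (m + 1)) {Y : Type} [Fintype Y]
    (q : Fin n → Sample (m + 1) → Y → ℝ) (hq : IsKernel q (2 ^ k))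
    (est : Y → EuclideanSpace ℝ (Fin (m + 1))) :
    1 / 1000 * max (((m + 1 : ℕ) : ℝ) ^ 2 / ((n : ℝ) * (k : ℝ))) (((m + 1 : ℕ) : ℝ) / (n : ℝ))
      ≤ worstRisk (fun x y => ∏ j, q j (x j) y) est (cube (m + 1)) := by
  set A := cubeMatrix (m + 1)
  have hval : ∀ t i, affineParam (1 / 2) A t i = 1 / 2 + t i / 4 := fun t i => by
    change 1 / 2 + ∑ l, A i l * t l = _
    rw [sum_cubeMatrix_mul]
  have hrange : ∀ t : Fin (m + 1) → ℝ, (∀ l, t l ∈ Set.Icc (-1 : ℝ) 1) → ∀ i,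
      affineParam (1 / 2) A t i ∈ Set.Icc (1 / 4 : ℝ) (3 / 4) := fun t ht i => by
    have := ht i
    rw [hval]
    constructor <;> linarith [this.1, this.2]
  have hIoo : ∀ t : Fin (m + 1) → ℝ, (∀ l, t l ∈ Set.Icc (-1 : ℝ) 1) → ∀ i,
      affineParam (1 / 2) A t i ∈ Set.Ioo (0 : ℝ) 1 := fun t ht i => by
    have := hrange t ht i
    constructor <;> linarith [this.1, this.2]
  have hinv0 : ∀ t : Fin (m + 1) → ℝ, (∀ l, t l ∈ Set.Icc (-1 : ℝ) 1) → ∀ i,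
      (affineParam (1 / 2) A t i)⁻¹ ≤ 4 := fun t ht i =>
    inv_le_of_le_mul (hIoo t ht i).1 (by linarith [(hrange t ht i).1])
  have hinv1 : ∀ t : Fin (m + 1) → ℝ, (∀ l, t l ∈ Set.Icc (-1 : ℝ) 1) → ∀ i,
      (1 - affineParam (1 / 2) A t i)⁻¹ ≤ 4 := fun t ht i =>
    inv_le_of_le_mul (sub_pos.2 (hIoo t ht i).2) (by linarith [(hrange t ht i).2])
  have hnn : ∀ t : Fin (m + 1) → ℝ, (∀ l, t l ∈ Set.Icc (-1 : ℝ) 1) → ∀ x,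
      0 ≤ bernMass (affineParam (1 / 2) A t) x := fun t ht =>
    bernMass_nonneg fun i => Set.Ioo_subset_Icc_self (hIoo t ht i)
  -- The map `t ↦ 1/2 + t/4` is inverted coordinatewise, so the squared loss is multiplied by
  -- exactly `16`.
  have key := fun I hI => affine_vanTrees hq est (Set.Subset.refl (cube (m + 1))) (1 / 2) A
    (fun t ht i => Set.Ioo_subset_Icc_self (hIoo t ht i)) hIoo I hI
    (fun y l => 4 * (est y l - 1 / 2)) (ρ := 16) (by norm_num) (fun t y => by
      rw [EuclideanSpace.real_norm_sq_eq, mul_sum]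
      refine (sum_congr rfl fun l _ => ?_).le
      rw [PiLp.sub_apply, hval]
      ring)
  -- The bound `4` on the inverses cancels the slope `1/4`, so the score is sub-Gaussian with
  -- parameter one; `log 2 ≤ 1` does the rest.
  have hlog := key (2 * k) (fun t ht j => by
    refine (sum_condScore_sq_le_log (hnn t ht) (sum_bernMass _) hq (fun u => ?_) j).trans ?_
    · simp only [sum_mul_affineScore]
      refine (sum_bernMass_mul_exp_le (hIoo t ht) (hinv0 t ht) (hinv1 t ht) _).trans (le_of_eq ?_)
      congr 2
      refine sum_congr rfl fun i _ => ?_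
      rw [sum_cubeMatrix_mul]
      ring
    · rw [Real.log_pow]
      have : Real.log 2 ≤ 1 := by linarith [Real.log_two_lt_d9]
      nlinarith [(Nat.cast_nonneg k : (0 : ℝ) ≤ k)])
  -- The variance constant is `8 * (1/4)² = 1/2`.
  have htrace := key (1 / 2 * ((m : ℝ) + 1)) (fun t ht j => by
    refine (sum_condScore_sq_le_trace (hnn t ht) (sum_bernMass _) hq j).trans ?_
    refine (trace_le_of_variance_le (affineScore_variance_le (hIoo t ht) (κ := 8)
      (fun i => by linarith [hinv0 t ht i, hinv1 t ht i]) (K := 1 / 2) fun u => ?_)).trans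
      (le_of_eq (by simp))
    simp only [A, sum_cubeMatrix_mul, mul_sum]
    exact sum_le_sum fun l _ => by linarith)
  set R := worstRisk (fun x y => ∏ j, q j (x j) y) est (cube (m + 1))
  have hnk : ((m : ℝ) + 1) ≤ n * k := by
    exact_mod_cast hd.trans (Nat.mul_le_mul_left n (min_le_left k (m + 1)))
  have hn : (1 : ℝ) ≤ n := by
    rcases Nat.eq_zero_or_pos n with h | h
    · simp [h] at hd
    · exact_mod_cast h
  have hm : (0 : ℝ) ≤ m := Nat.cast_nonneg m
  -- A nonpositive `R` would make the right side of `hlog` nonpositive, while its left side is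
  -- positive.
  have hR : 0 < R := by
    by_contra! hR
    have : 0 ≤ 2 * ((n : ℝ) * (2 * k)) + 8 * ((m : ℝ) + 1) := by positivity
    nlinarith
  push_cast
  rw [mul_max_of_nonneg _ _ (by norm_num : (0 : ℝ) ≤ 1 / 1000)]
  refine max_le ?_ ?_
  · rw [← mul_div_assoc, div_le_iff₀ (by linarith)]
    nlinarith [mul_le_mul_of_nonneg_left hnk hR.le]
  · rw [← mul_div_assoc, div_le_iff₀ (by linarith)]
    have h1 : ((m : ℝ) + 1) * (4 / 9 * (m + 1)) ≤ (m + 1) * (144 * (R * n)) := by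
      have : R ≤ R * n := le_mul_of_one_le_right hR.le hn
      nlinarith [mul_le_mul_of_nonneg_right this (by linarith : (0 : ℝ) ≤ m + 1)]
    have h2 := le_of_mul_le_mul_left h1 (by linarith)
    nlinarith

/-! ### The sparse parameter set -/

/-- The matrix of the family of parameters on the simplex in which the entries with indices
`e.symm (inl l)` and `e.symm (inr (inl l))` move by `δ` in opposite directions. -/
def pairMatrix {d D r : ℕ} (e : Fin d ≃ Fin D ⊕ (Fin D ⊕ Fin r)) (δ : ℝ) (i : Fin d)
    (l : Fin D) : ℝ :=
  δ * Sum.elim (fun a => if a = l then 1 else 0)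
    (Sum.elim (fun a => if a = l then -1 else 0) fun _ => 0) (e i)

theorem sum_pairMatrix_mul {d D r : ℕ} (e : Fin d ≃ Fin D ⊕ (Fin D ⊕ Fin r)) (δ : ℝ)
    (u : Fin D → ℝ) (i : Fin d) :
    ∑ l, pairMatrix e δ i l * u l
      = δ * Sum.elim u (Sum.elim (fun l => -u l) fun _ => 0) (e i) := by
  simp only [pairMatrix, mul_assoc, ← mul_sum]
  congr 1
  rcases e i with a | a | a <;> simp

theorem sum_sum_pairMatrix_mul_sq {d D r : ℕ} (e : Fin d ≃ Fin D ⊕ (Fin D ⊕ Fin r)) (δ : ℝ)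
    (u : Fin D → ℝ) :
    ∑ i, (∑ l, pairMatrix e δ i l * u l) ^ 2 = 2 * δ ^ 2 * ∑ l, u l ^ 2 := by
  simp only [sum_pairMatrix_mul]
  rw [e.sum_comp fun z => (δ * Sum.elim u (Sum.elim (fun l => -u l) fun _ => 0) z) ^ 2]
  simp [mul_pow, ← mul_sum]
  ring

theorem worstRisk_sparseSet_ge {n k d m r : ℕ} (hmr : d = (m + 1) + ((m + 1) + r))
    (hr : r ≤ 1) (hd : d ^ 2 ≤ n * min (2 ^ k) d) {Y : Type} [Fintype Y]
    (q : Fin n → Sample d → Y → ℝ) (hq : IsKernel q (2 ^ k))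
    (est : Y → EuclideanSpace ℝ (Fin d)) :
    1 / 1000 * max ((d : ℝ) / ((n : ℝ) * (2 : ℝ) ^ k)) (1 / (n : ℝ))
      ≤ worstRisk (fun x y => ∏ j, q j (x j) y) est (sparseSet d) := by
  obtain ⟨e⟩ : Nonempty (Fin d ≃ Fin (m + 1) ⊕ (Fin (m + 1) ⊕ Fin r)) :=
    ⟨Fintype.equivOfCardEq (by simp [hmr])⟩
  have hd2 : (2 : ℝ) ≤ d := by
    have : 2 ≤ d := by omega
    exact_mod_cast this
  have hd0 : (0 : ℝ) < d := by linarith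
  set A := pairMatrix e (1 / (2 * (d : ℝ)))
  have hval : ∀ t i, affineParam (1 / (d : ℝ)) A t i
      = 1 / d + 1 / (2 * (d : ℝ)) * Sum.elim t (Sum.elim (fun l => -t l) fun _ => 0) (e i) :=
    fun t i => by
      change 1 / (d : ℝ) + ∑ l, A i l * t l = _
      rw [sum_pairMatrix_mul]
  have hrange : ∀ t : Fin (m + 1) → ℝ, (∀ l, t l ∈ Set.Icc (-1 : ℝ) 1) → ∀ i,
      affineParam (1 / (d : ℝ)) A t i ∈ Set.Icc (1 / (2 * (d : ℝ))) (3 / 4) := fun t ht i => by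
    have hs : Sum.elim t (Sum.elim (fun l => -t l) fun _ => 0) (e i) ∈ Set.Icc (-1 : ℝ) 1 := by
      rcases e i with a | a | a
      · exact ht a
      · have := ht a
        simp only [Sum.elim_inr, Sum.elim_inl]
        constructor <;> linarith [this.1, this.2]
      · simp
    have hh : 1 / (d : ℝ) = 2 * (1 / (2 * (d : ℝ))) := by field_simp
    have hpos : 0 < 1 / (2 * (d : ℝ)) := by positivity
    have hle : 1 / (2 * (d : ℝ)) ≤ 1 / 4 := by
      rw [div_le_div_iff₀ (by positivity) (by norm_num)]
      linarith
    rw [hval, hh]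
    constructor <;> nlinarith [hs.1, hs.2]
  have hIoo : ∀ t : Fin (m + 1) → ℝ, (∀ l, t l ∈ Set.Icc (-1 : ℝ) 1) → ∀ i,
      affineParam (1 / (d : ℝ)) A t i ∈ Set.Ioo (0 : ℝ) 1 := fun t ht i => by
    have := hrange t ht i
    have hpos : 0 < 1 / (2 * (d : ℝ)) := by positivity
    constructor <;> linarith [this.1, this.2]
  -- The sum of the inverses is at most `2d + 4`, and `4 ≤ 2d`.
  have hinv : ∀ t : Fin (m + 1) → ℝ, (∀ l, t l ∈ Set.Icc (-1 : ℝ) 1) → ∀ i,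
      (affineParam (1 / (d : ℝ)) A t i)⁻¹ + (1 - affineParam (1 / (d : ℝ)) A t i)⁻¹
        ≤ 4 * d := fun t ht i => by
    have h1 : (affineParam (1 / (d : ℝ)) A t i)⁻¹ ≤ 2 * d :=
      inv_le_of_le_mul (hIoo t ht i).1 (by
        have := mul_le_mul_of_nonneg_left (hrange t ht i).1 (by positivity : 0 ≤ 2 * (d : ℝ))
        rwa [mul_one_div_cancel (by positivity)] at this)
    have h2 : (1 - affineParam (1 / (d : ℝ)) A t i)⁻¹ ≤ 4 :=
      inv_le_of_le_mul (sub_pos.2 (hIoo t ht i).2) (by linarith [(hrange t ht i).2])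
    linarith
  have hnn : ∀ t : Fin (m + 1) → ℝ, (∀ l, t l ∈ Set.Icc (-1 : ℝ) 1) → ∀ x,
      0 ≤ bernMass (affineParam (1 / (d : ℝ)) A t) x := fun t ht =>
    bernMass_nonneg fun i => Set.Ioo_subset_Icc_self (hIoo t ht i)
  -- The constant is `4d * 2δ² = 2/d` for `δ = 1/(2d)`.
  have hvar : ∀ t : Fin (m + 1) → ℝ, (∀ l, t l ∈ Set.Icc (-1 : ℝ) 1) → ∀ u : Fin (m + 1) → ℝ,
      ∑ x, bernMass (affineParam (1 / (d : ℝ)) A t) x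
        * (∑ l, u l * affineScore (1 / (d : ℝ)) A t x l) ^ 2 ≤ 2 / d * ∑ l, u l ^ 2 :=
    fun t ht => affineScore_variance_le (hIoo t ht) (hinv t ht) fun u => by
      rw [sum_sum_pairMatrix_mul_sq, ← mul_assoc]
      refine (congrArg (· * _) ?_).le
      field_simp
      norm_num
  have key := fun I hI => affine_vanTrees hq est (fun _ hθ => hθ.1 : sparseSet d ⊆ cube d)
    (1 / (d : ℝ)) A
    (fun t ht => ⟨fun i => Set.Ioo_subset_Icc_self (hIoo t ht i), by
      simp only [hval]
      rw [sum_add_distrib, ← mul_sum,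
        e.sum_comp (Sum.elim t (Sum.elim (fun l => -t l) fun _ => 0))]
      simp [hd0.ne']⟩) hIoo I hI
    -- The two coordinates of a pair differ by `2δ * t l = t l / d`, hence the factor `d`; `(a - b)²
    -- ≤ 2a² + 2b²` gives the loss factor `2d²`.
    (fun y l => d * (est y (e.symm (Sum.inl l)) - est y (e.symm (Sum.inr (Sum.inl l)))))
    (ρ := 2 * (d : ℝ) ^ 2) (by positivity) (fun t y => by
      rw [EuclideanSpace.real_norm_sq_eq, ← e.symm.sum_comp, Fintype.sum_sum_type,
        Fintype.sum_sum_type, ← add_assoc, ← sum_add_distrib, mul_add, mul_sum]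
      refine le_add_of_le_of_nonneg (sum_le_sum fun l _ => ?_)
        (mul_nonneg (by positivity) (sum_nonneg fun i _ => sq_nonneg (_ : ℝ)))
      simp only [PiLp.sub_apply, hval, Equiv.apply_symm_apply, Sum.elim_inl, Sum.elim_inr]
      set a := est y (e.symm (Sum.inl l))
      set b := est y (e.symm (Sum.inr (Sum.inl l)))
      have e1 : (d : ℝ) * (a - b) - t l = d * ((a - (1 / d + 1 / (2 * (d : ℝ)) * t l))
          - (b - (1 / d + 1 / (2 * (d : ℝ)) * -t l))) := by
        field_simp
        ring
      rw [e1, mul_pow, mul_comm (2 : ℝ) ((d : ℝ) ^ 2), mul_assoc]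
      refine mul_le_mul_of_nonneg_left ?_ (sq_nonneg (d : ℝ))
      nlinarith [sq_nonneg ((a - (1 / d + 1 / (2 * (d : ℝ)) * t l))
          + (b - (1 / d + 1 / (2 * (d : ℝ)) * -t l)))])
  have hmul := key (2 / d * 2 ^ k) fun t ht j =>
    sum_condScore_sq_le_mul (hnn t ht) (sum_bernMass _) hq (by positivity) (hvar t ht) j
  have htrace := key (2 / d * ((m : ℝ) + 1)) fun t ht j =>
    (sum_condScore_sq_le_trace (hnn t ht) (sum_bernMass _) hq j).trans
      ((trace_le_of_variance_le (hvar t ht)).trans (le_of_eq (by simp)))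
  set R := worstRisk (fun x y => ∏ j, q j (x j) y) est (sparseSet d)
  have hnk : (d : ℝ) ^ 2 ≤ n * 2 ^ k := by
    exact_mod_cast hd.trans (Nat.mul_le_mul_left n (min_le_left _ _))
  have hnd : (d : ℝ) ^ 2 ≤ n * d := by
    exact_mod_cast hd.trans (Nat.mul_le_mul_left n (min_le_right _ _))
  have hn : (d : ℝ) ≤ n := by nlinarith
  have hm : (0 : ℝ) ≤ m := Nat.cast_nonneg m
  -- At most one coordinate is unpaired, so the number of pairs is at least `d / 3`; this is the
  -- source of `4 / 81`.
  have hd3 : (d : ℝ) ≤ 3 * (m + 1) := by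
    have : d ≤ 3 * (m + 1) := by omega
    exact_mod_cast this
  have hmd : 2 * ((m : ℝ) + 1) ≤ d := by
    have : 2 * (m + 1) ≤ d := by omega
    exact_mod_cast this
  have hlow : 4 / 81 * (d : ℝ) ^ 2 ≤ (2 * ((m : ℝ) + 1) / 3) ^ 2 := by nlinarith
  have hfin : ∀ J : ℝ, 0 < J → (2 * ((m : ℝ) + 1) / 3) ^ 2 ≤ 2 * (d : ℝ) ^ 2 * R * J →
      4 / 81 ≤ 2 * R * J := by
    intro J hJ h
    refine le_of_mul_le_mul_left ?_ (by positivity : (0 : ℝ) < (d : ℝ) ^ 2)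
    linarith
  have hR : 0 < R := by
    have hJ : 0 < 2 * ((n : ℝ) * (2 / d * ((m : ℝ) + 1))) + 8 * ((m : ℝ) + 1) := by positivity
    have := hfin _ hJ htrace
    by_contra! hR
    nlinarith
  rw [mul_max_of_nonneg _ _ (by norm_num : (0 : ℝ) ≤ 1 / 1000)]
  refine max_le ?_ ?_
  · have hnk0 : 0 < (n : ℝ) * 2 ^ k := lt_of_lt_of_le (by positivity) hnk
    have h1 := hfin _ (by positivity) hmul
    -- The prior term is at most `4d`, absorbed by `4 * n * 2 ^ k / d` because `d² ≤ n * 2 ^ k`.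
    have h2 : 2 * ((n : ℝ) * (2 / d * 2 ^ k)) + 8 * ((m : ℝ) + 1) ≤ 8 * (n * 2 ^ k) / d := by
      rw [le_div_iff₀ hd0]
      have : 2 * ((n : ℝ) * (2 / d * 2 ^ k)) * d = 4 * (n * 2 ^ k) := by
        field_simp
        ring
      nlinarith
    have h3 := h1.trans (mul_le_mul_of_nonneg_left h2 (by positivity))
    rw [← mul_div_assoc, le_div_iff₀ hd0] at h3
    rw [← mul_div_assoc, div_le_iff₀ hnk0]
    nlinarith
  · have hn0 : (0 : ℝ) < n := by linarith
    have h1 := hfin _ (by positivity) htrace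
    have h2 : 2 * ((n : ℝ) * (2 / d * ((m : ℝ) + 1))) + 8 * ((m : ℝ) + 1) ≤ 6 * n := by
      have : 2 / (d : ℝ) * (m + 1) ≤ 1 := by
        rw [div_mul_eq_mul_div, div_le_one hd0]
        exact hmd
      nlinarith
    have h3 := h1.trans (mul_le_mul_of_nonneg_left h2 (by positivity))
    rw [← mul_div_assoc, div_le_iff₀ hn0]
    nlinarith

end DistEst

end

theorem mainTheorem8 :
    ∃ C : ℝ, 0 < C ∧
      (∀ n k d : ℕ, 1 ≤ d → d ≤ n * min k d →
        DistEst.RiskAtLeast n k d (DistEst.cube d)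
          (C * max ((d : ℝ) ^ 2 / ((n : ℝ) * (k : ℝ))) ((d : ℝ) / (n : ℝ)))) ∧
      (∀ n k d : ℕ, 2 ≤ d → d ^ 2 ≤ n * min (2 ^ k) d →
        DistEst.RiskAtLeast n k d (DistEst.sparseSet d)
          (C * max ((d : ℝ) / ((n : ℝ) * (2 : ℝ) ^ k)) (1 / (n : ℝ)))) := by
  refine ⟨1 / 1000, by norm_num, fun n k d h1 hd => ?_, fun n k d h2 hd => ?_⟩
  · obtain ⟨m, rfl⟩ : ∃ m, d = m + 1 := ⟨d - 1, by omega⟩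
    exact DistEst.riskAtLeast_of_isKernel fun q hq est => DistEst.worstRisk_cube_ge hd q hq est
  · exact DistEst.riskAtLeast_of_isKernel fun q hq est =>
      -- There are `m + 1 = d / 2` pairs, with one coordinate left fixed when `d` is odd.
      DistEst.worstRisk_sparseSet_ge (m := d / 2 - 1) (r := d % 2) (by omega) (by omega) hd q hq est
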